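/- **Setting.** Let $\mathbb{Z}^+=\{0,1,2,\dots\}$, let $\mathcal{S}$ be an unbounded subset of $[0,\infty)$, and let $X=(X_t)_{t\in\mathbb{Z}^+}$ be a stochastic process with values in $\mathcal{S}$, adapted to a filtration $(\mathcal{F}_t)_{t\in\mathbb{Z}^+}$ on a probability space. Assume: * (A0) for some $x_0\in\mathcal{S}$, $\Pr[X_0\le x_0\mid\mathcal{F}_0]=1$ a.s.; * (A1) $\limsup_{t\to\infty}X_t=\infty$ a.s.; * for some $\beta\in[0,1)$, $\gamma>2+2\beta$ and $B<\infty$, $\ \sup_{t\in\mathbb{Z}^+}\mathbb{E}\big[|X_{t+1}-X_t|^{\gamma}\mid\mathcal{F}_t\big]\le B$ a.s. For each $t$ let $\phi_t$ be a real Borel function and $\psi_t$ an $\mathcal{F}_t$-measurable random variable with $\mathbb{E}[\psi_t\mid X_t]=0$ such that, a.s., $$\mathbb{E}[X_{t+1}-X_t\mid\mathcal{F}_t]=\mathbb{E}[X_{t+1}-X_t\mid X_t]+\psi_t=\phi_t(X_t)+\psi_t ,$$ and for $x\in\mathcal{S}$ put $$\overline{\mu}_1(x)=\sup_{t\in\mathbb{Z}^+}\operatorname{ess\,sup}\,(\phi_t(x)+\psi_t),\qquad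 \underline{\mu}_1(x)=\inf_{t\in\mathbb{Z}^+}\operatorname{ess\,inf}\,(\phi_t(x)+\psi_t).$$ **Theorem.** Let $a,A\in(0,\infty)$ with $a\le A$, and suppose that, as $x\to\infty$ in $\mathcal{S}$, $$\liminf_{x\to\infty}x^{\beta}\underline{\mu}_1(x)=a\quad\text{and}\quad\limsup_{x\to\infty}x^{\beta}\overline{\mu}_1(x)=A .$$ Then, almost surely, $$(a(1+\beta))^{\frac1{1+\beta}}\le\liminf_{t\to\infty}\frac{X_t}{t^{1/(1+\beta)}}\le\limsup_{t\to\infty}\frac{X_t}{t^{1/(1+\beta)}}\le(A(1+\beta))^{\frac1{1+\beta}} .$$ The same conclusion holds, more generally, when $\underline{\mu}_1,\overline{\mu}_1$ are replaced in the hypothesis by any functions $l,u$ from $\mathcal{S}$ to $[-\infty,\infty]$ such that, for every $t\in\mathbb{Z}^+$, $\ l(X_t)\le\mathbb{E}[X_{t+1}-X_t\mid\mathcal{F}_t]\le u(X_t)$ a.s. -/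

import Mathlib

open MeasureTheory Filter
open scoped ProbabilityTheory

/-- Basic assumption on the process: `S` is an unbounded subset of `[0,∞)`, the process `X` takes
values in `S` and is adapted to the filtration `F`, and for some `x₀ ∈ S` one has
`P[X₀ ≤ x₀ | F₀] = 1` almost surely. -/
structure IsHalfLineProcess {Ω : Type*} {m : MeasurableSpace Ω} (P : Measure Ω)
    (F : Filtration ℕ m) (S : Set ℝ) (X : ℕ → Ω → ℝ) : Prop where
  nonneg : ∀ x ∈ S, 0 ≤ x
  unbounded : ¬ BddAbove S
  mem : ∀ t ω, X t ω ∈ S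
  adapted : Adapted F X
  initial : ∃ x₀ ∈ S, P⟦{ω | X 0 ω ≤ x₀} | F 0⟧ =ᵐ[P] fun _ => 1

/-- `limsup_{t → ∞} X_t = ∞` almost surely. -/
def LimsupInfinite {Ω : Type*} {m : MeasurableSpace Ω} (P : Measure Ω) (X : ℕ → Ω → ℝ) : Prop :=
  ∀ᵐ ω ∂P, limsup (fun t => (X t ω : EReal)) atTop = ⊤

/-- `sup_t E[|X_{t+1} - X_t|^γ | F_t] ≤ B` almost surely. The integrability clause makes the
conditional expectations genuine. -/
def IncrementMomentBound {Ω : Type*} {m : MeasurableSpace Ω} (P : Measure Ω)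
    (F : Filtration ℕ m) (X : ℕ → Ω → ℝ) (γ B : ℝ) : Prop :=
  ∀ t, Integrable (fun ω => |X (t + 1) ω - X t ω| ^ γ) P ∧
    ∀ᵐ ω ∂P, (P[fun ω' => |X (t + 1) ω' - X t ω'| ^ γ | F t]) ω ≤ B

/-- The one-step mean drift `E[X_{t+1} - X_t | F_t]`. -/
noncomputable def meanDrift {Ω : Type*} {m : MeasurableSpace Ω} (P : Measure Ω)
    (F : Filtration ℕ m) (X : ℕ → Ω → ℝ) (t : ℕ) : Ω → ℝ :=
  P[fun ω => X (t + 1) ω - X t ω | F t]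

/-- Decomposition of the mean drift, for every `t`: almost surely
`E[X_{t+1} - X_t | F_t] = E[X_{t+1} - X_t | X_t] + ψ_t = φ_t(X_t) + ψ_t`, with `φ_t` Borel
and `ψ_t` an `F_t`-measurable random variable with `E[ψ_t | X_t] = 0`. (A Borel function on the
state space extends to a Borel function on `ℝ`; its values off the state space play no role.) -/
structure IsDriftDecomposition {Ω : Type*} {m : MeasurableSpace Ω} (P : Measure Ω)
    (F : Filtration ℕ m) (X : ℕ → Ω → ℝ) (φ : ℕ → ℝ → ℝ) (ψ : ℕ → Ω → ℝ) : Prop where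
  measurable_phi : ∀ t, Measurable (φ t)
  measurable_psi : ∀ t, Measurable[F t] (ψ t)
  condExp_increment : ∀ t,
    P[fun ω => X (t + 1) ω - X t ω | MeasurableSpace.comap (X t) inferInstance]
      =ᵐ[P] fun ω => φ t (X t ω)
  condExp_psi : ∀ t, P[ψ t | MeasurableSpace.comap (X t) inferInstance] =ᵐ[P] fun _ => 0
  meanDrift_eq : ∀ t, meanDrift P F X t =ᵐ[P] fun ω => φ t (X t ω) + ψ t ω

/-- The upper drift function `x ↦ sup_t ess sup (φ_t(x) + ψ_t)`. -/
noncomputable def upperDrift {Ω : Type*} {m : MeasurableSpace Ω} (P : Measure Ω)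
    (φ : ℕ → ℝ → ℝ) (ψ : ℕ → Ω → ℝ) (x : ℝ) : EReal :=
  ⨆ t, essSup (fun ω => ((φ t x + ψ t ω : ℝ) : EReal)) P

/-- The lower drift function `x ↦ inf_t ess inf (φ_t(x) + ψ_t)`. -/
noncomputable def lowerDrift {Ω : Type*} {m : MeasurableSpace Ω} (P : Measure Ω)
    (φ : ℕ → ℝ → ℝ) (ψ : ℕ → Ω → ℝ) (x : ℝ) : EReal :=
  ⨅ t, essInf (fun ω => ((φ t x + ψ t ω : ℝ) : EReal)) P

/-- `l` and `u` bound the mean drift from below and above as functions of the current state: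
`l(X_t) ≤ E[X_{t+1} - X_t | F_t] ≤ u(X_t)` almost surely, for every `t`. -/
def DriftBetween {Ω : Type*} {m : MeasurableSpace Ω} (P : Measure Ω)
    (F : Filtration ℕ m) (X : ℕ → Ω → ℝ) (l u : ℝ → EReal) : Prop :=
  ∀ t, ∀ᵐ ω ∂P, l (X t ω) ≤ (meanDrift P F X t ω : EReal) ∧
    (meanDrift P F X t ω : EReal) ≤ u (X t ω)

/-- `liminf x^β l(x) = a` and `limsup x^β u(x) = A` as `x → ∞` within the state space `S`. -/
def DriftAsymptotics (S : Set ℝ) (β a A : ℝ) (l u : ℝ → EReal) : Prop :=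
  liminf (fun x : ℝ => ((x ^ β : ℝ) : EReal) * l x) (atTop ⊓ 𝓟 S) = (a : EReal) ∧
    limsup (fun x : ℝ => ((x ^ β : ℝ) : EReal) * u x) (atTop ⊓ 𝓟 S) = (A : EReal)

/-- The constant `λ(a,β) = (a(1+β))^{1/(1+β)}`. -/
noncomputable def escapeConst (a β : ℝ) : ℝ := (a * (1 + β)) ^ (1 / (1 + β))

/-- Almost surely,
`λ(a,β) ≤ liminf X_t / t^{1/(1+β)} ≤ limsup X_t / t^{1/(1+β)} ≤ λ(A,β)` as `t → ∞`. -/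
def EscapeBounds {Ω : Type*} {m : MeasurableSpace Ω} (P : Measure Ω)
    (X : ℕ → Ω → ℝ) (β a A : ℝ) : Prop :=
  ∀ᵐ ω ∂P,
    (escapeConst a β : EReal)
        ≤ liminf (fun t : ℕ => ((X t ω / (t : ℝ) ^ (1 / (1 + β)) : ℝ) : EReal)) atTop ∧
    liminf (fun t : ℕ => ((X t ω / (t : ℝ) ^ (1 / (1 + β)) : ℝ) : EReal)) atTop
        ≤ limsup (fun t : ℕ => ((X t ω / (t : ℝ) ^ (1 / (1 + β)) : ℝ) : EReal)) atTop ∧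
    limsup (fun t : ℕ => ((X t ω / (t : ℝ) ^ (1 / (1 + β)) : ℝ) : EReal)) atTop
        ≤ (escapeConst A β : EReal)

/-! Put U = 1 + X and Y = U^(1+β). Expanding to second order, the conditional drift of Y is (1+β)
U^β times the drift of U, with an error of order U^(β-1). Hence, where U is large, it lies nearly
between (1+β)a and (1+β)A. If U → ∞, averaging these drifts traps Y_n / n asymptotically in the same
interval, and taking the (1+β)-th root gives the claim.

Two facts carry this. Transience (`ae_tendsto_atTop`): 1/U, truncated above at a small level, is a
supermartingale, so it converges, and the unboundedness of U forces the limit to be 0. Averaging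
(`ae_tendsto_average_sub_condExp`): the strong law for martingale differences needs the second
moments of the increments of Y to be summable against t^(-2). These are O(E[U^(2β)]) = O(E[Y^θ])
with θ = 2β/(1+β) < 1, while E[Y_t] = O(t), so they are O(t^θ). -/

/-! ### Strong law for martingale differences -/

/-- A square-integrable `m'`-measurable function is orthogonal to the conditional fluctuation
`ξ - E[ξ | m']`. -/
lemma integral_mul_sub_condExp_eq_zero {Ω : Type*} {m' m : MeasurableSpace Ω} {P : Measure Ω}
    [IsProbabilityMeasure P] (hm : m' ≤ m) {f ξ : Ω → ℝ} (hf : StronglyMeasurable[m'] f)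
    (hf2 : MemLp f 2 P) (hξ : MemLp ξ 2 P) :
    ∫ ω, f ω * (ξ ω - (P[ξ | m']) ω) ∂P = 0 := by
  have h1 : Integrable (f * ξ) P := hf2.integrable_mul hξ
  have hD : MemLp (P[ξ | m']) 2 P := hξ.condExp one_le_two
  have h2 : Integrable (f * P[ξ | m']) P := hf2.integrable_mul hD
  have h3 := condExp_mul_of_stronglyMeasurable_left hf h1 (hξ.integrable one_le_two)
  have h4 : ∫ ω, (f * ξ) ω ∂P = ∫ ω, (f * P[ξ | m']) ω ∂P := by
    exact (integral_condExp hm).symm.trans (integral_congr_ae h3)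
  have h5 : (fun ω => f ω * (ξ ω - (P[ξ | m']) ω))
      = fun ω => (f * ξ) ω - (f * P[ξ | m']) ω := by
    ext ω; simp [mul_sub]
  rw [h5, integral_sub h1 h2, h4, sub_self]

/-- Pythagoras: ξ splits into its conditional expectation and an orthogonal fluctuation. -/
lemma integral_sub_condExp_sq_le {Ω : Type*} {m' m : MeasurableSpace Ω} {P : Measure Ω}
    [IsProbabilityMeasure P] (hm : m' ≤ m) {ξ : Ω → ℝ} (hξ : MemLp ξ 2 P) :
    ∫ ω, (ξ ω - (P[ξ | m']) ω) ^ 2 ∂P ≤ ∫ ω, ξ ω ^ 2 ∂P := by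
  have hD : MemLp (P[ξ | m']) 2 P := hξ.condExp one_le_two
  have h0 := integral_mul_sub_condExp_eq_zero hm stronglyMeasurable_condExp hD hξ
  have hd : MemLp (fun ω => ξ ω - (P[ξ | m']) ω) 2 P := hξ.sub hD
  have e : (fun ω => ξ ω ^ 2) = fun ω => (ξ ω - (P[ξ | m']) ω) ^ 2 + ((P[ξ | m']) ω ^ 2
      + 2 * ((P[ξ | m']) ω * (ξ ω - (P[ξ | m']) ω))) := by
    ext ω; ring
  have hi : Integrable (fun ω => (P[ξ | m']) ω * (ξ ω - (P[ξ | m']) ω)) P :=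
    hD.integrable_mul hd
  have hi2 : Integrable (fun ω => (P[ξ | m']) ω ^ 2
      + 2 * ((P[ξ | m']) ω * (ξ ω - (P[ξ | m']) ω))) P := hD.integrable_sq.add (hi.const_mul 2)
  rw [e, integral_add hd.integrable_sq hi2, integral_add hD.integrable_sq (hi.const_mul 2), integral_const_mul, h0]
  have : 0 ≤ ∫ ω, (P[ξ | m']) ω ^ 2 ∂P := integral_nonneg fun ω => sq_nonneg _
  linarith

/-- Kronecker's lemma for the weights `1 / (t + 1)`. -/
lemma tendsto_average_of_tendsto_sum_div {x : ℕ → ℝ} {l : ℝ}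
    (h : Tendsto (fun n => ∑ t ∈ Finset.range n, x t / ((t : ℝ) + 1)) atTop (nhds l)) :
    Tendsto (fun n : ℕ => (n : ℝ)⁻¹ * ∑ t ∈ Finset.range n, x t) atTop (nhds 0) := by
  set N : ℕ → ℝ := fun n => ∑ t ∈ Finset.range n, x t / ((t : ℝ) + 1) with hN
  -- Summation by parts. Divided by n, the right side is `N n` minus its Cesàro mean, and both tend
  -- to `l`.
  have key : ∀ n : ℕ, ∑ t ∈ Finset.range n, x t = n * N n - ∑ t ∈ Finset.range n, N t := by
    intro n
    induction n with
    | zero => simp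
    | succ n ih =>
      have : N (n + 1) = N n + x n / ((n : ℝ) + 1) := by simp [hN, Finset.sum_range_succ]
      rw [Finset.sum_range_succ, Finset.sum_range_succ, ih, this]
      push_cast
      field_simp
      ring
  have h2 := h.sub h.cesaro
  rw [sub_self] at h2
  refine h2.congr' ?_
  filter_upwards [eventually_gt_atTop 0] with n hn
  rw [key n, mul_sub, inv_mul_cancel_left₀ (by positivity)]

/-- Strong law of large numbers for square-integrable martingale differences. -/
theorem ae_tendsto_average_sub_condExp {Ω : Type*} {m : MeasurableSpace Ω} {P : Measure Ω}
    [IsProbabilityMeasure P] {F : Filtration ℕ m} {ξ : ℕ → Ω → ℝ}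
    (hmeas : ∀ t, StronglyMeasurable[F (t + 1)] (ξ t)) (hL2 : ∀ t, MemLp (ξ t) 2 P)
    (hsum : Summable fun t : ℕ => (∫ ω, ξ t ω ^ 2 ∂P) / ((t : ℝ) + 1) ^ 2) :
    ∀ᵐ ω ∂P, Tendsto (fun n : ℕ => (n : ℝ)⁻¹ *
      ∑ t ∈ Finset.range n, (ξ t ω - (P[ξ t | F t]) ω)) atTop (nhds 0) := by
  set N : ℕ → Ω → ℝ := fun n ω =>
    ∑ t ∈ Finset.range n, (ξ t ω - (P[ξ t | F t]) ω) / ((t : ℝ) + 1) with hN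
  have hd : ∀ t, MemLp (fun ω => ξ t ω - (P[ξ t | F t]) ω) 2 P := fun t =>
    (hL2 t).sub ((hL2 t).condExp one_le_two)
  have hN2 : ∀ n, MemLp (N n) 2 P := fun n =>
    memLp_finsetSum _ fun t _ => by
      simpa only [div_eq_mul_inv, mul_comm] using (hd t).const_mul ((t : ℝ) + 1)⁻¹
  have hadp : StronglyAdapted F N := by
    intro n
    refine Finset.stronglyMeasurable_fun_sum _ fun t ht => ?_
    have ht' : t + 1 ≤ n := Finset.mem_range.1 ht
    have h1 : StronglyMeasurable[F n] (ξ t) := (hmeas t).mono (F.mono ht')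
    have h2 : StronglyMeasurable[F n] (P[ξ t | F t]) :=
      stronglyMeasurable_condExp.mono (F.mono (Nat.le_of_succ_le ht'))
    simp only [div_eq_mul_inv]
    exact (h1.sub h2).mul_const ((t : ℝ) + 1)⁻¹
  have hstep : ∀ n, N (n + 1) - N n
      = ((n : ℝ) + 1)⁻¹ • (ξ n - P[ξ n | F n]) := by
    intro n
    ext ω
    simp [hN, Finset.sum_range_succ, div_eq_inv_mul]
  have hmart : Martingale N F P := by
    refine martingale_of_condExp_sub_eq_zero_nat hadp
      (fun n => (hN2 n).integrable one_le_two) fun n => ?_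
    rw [hstep n]
    have hi := (hL2 n).integrable one_le_two
    have e1 := condExp_smul (((n : ℝ) + 1)⁻¹) (ξ n - P[ξ n | F n]) (F n) (μ := P)
    have e2 := condExp_sub hi (integrable_condExp (f := ξ n) (m := F n) (μ := P)) (F n)
    have e3 := condExp_condExp_of_le (f := ξ n) (μ := P) le_rfl (F.le n)
    filter_upwards [e1, e2, e3] with ω h1 h2 h3
    rw [h1, Pi.smul_apply, h2, Pi.sub_apply, h3]
    simp
  have hvar : ∀ n, ∫ ω, N n ω ^ 2 ∂P
      ≤ ∑ t ∈ Finset.range n, (∫ ω, ξ t ω ^ 2 ∂P) / ((t : ℝ) + 1) ^ 2 := by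
    intro n
    induction n with
    | zero => simp [hN]
    | succ n ih =>
      have e : (fun ω => N (n + 1) ω ^ 2) = fun ω => N n ω ^ 2
          + (2 * ((n : ℝ) + 1)⁻¹ * (N n ω * (ξ n ω - (P[ξ n | F n]) ω))
          + (((n : ℝ) + 1)⁻¹) ^ 2 * (ξ n ω - (P[ξ n | F n]) ω) ^ 2) := by
        ext ω
        have := congrFun (hstep n) ω
        simp only [Pi.sub_apply, Pi.smul_apply, smul_eq_mul] at this
        rw [← sub_add_cancel (N (n + 1) ω) (N n ω), this]
        ring
      have hi : Integrable (fun ω => N n ω * (ξ n ω - (P[ξ n | F n]) ω)) P :=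
        (hN2 n).integrable_mul (hd n)
      have hi2 : Integrable (fun ω => 2 * ((n : ℝ) + 1)⁻¹ * (N n ω * (ξ n ω - (P[ξ n | F n]) ω))
          + (((n : ℝ) + 1)⁻¹) ^ 2 * (ξ n ω - (P[ξ n | F n]) ω) ^ 2) P :=
        (hi.const_mul _).add ((hd n).integrable_sq.const_mul _)
      rw [e, integral_add (hN2 n).integrable_sq hi2,
        integral_add (hi.const_mul _) ((hd n).integrable_sq.const_mul _),
        integral_const_mul, integral_const_mul,
        integral_mul_sub_condExp_eq_zero (F.le n) (hadp n) (hN2 n) (hL2 n),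
        Finset.sum_range_succ, mul_zero, zero_add, div_eq_inv_mul, inv_pow]
      exact add_le_add ih (mul_le_mul_of_nonneg_left
        (integral_sub_condExp_sq_le (F.le n) (hL2 n)) (by positivity))
  -- Martingale convergence asks only for an L¹ bound, obtained from the variances through |x| ≤ 1 +
  -- x².
  have hbdd : ∀ n, eLpNorm (N n) 1 P ≤ ((1 + ∑' t : ℕ,
      (∫ ω, ξ t ω ^ 2 ∂P) / ((t : ℝ) + 1) ^ 2).toNNReal : NNReal) := by
    intro n
    have hi := (hN2 n).integrable one_le_two
    rw [eLpNorm_one_eq_lintegral_enorm, ← ofReal_integral_norm_eq_lintegral_enorm hi]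
    refine ENNReal.ofReal_le_ofReal ?_
    have h1 : ∫ ω, ‖N n ω‖ ∂P ≤ ∫ ω, (1 + N n ω ^ 2) ∂P := by
      refine integral_mono hi.norm ((integrable_const 1).add (hN2 n).integrable_sq) fun ω => ?_
      simp only [Real.norm_eq_abs]
      rw [← sq_abs]
      nlinarith [sq_nonneg (|N n ω| - 1)]
    rw [integral_add (integrable_const 1) (hN2 n).integrable_sq] at h1
    have h2 := hsum.sum_le_tsum (Finset.range n) fun t _ =>
      div_nonneg (integral_nonneg fun ω => sq_nonneg (ξ t ω)) (sq_nonneg _)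
    have h3 := hvar n
    simp only [integral_const, probReal_univ, smul_eq_mul, mul_one] at h1
    linarith
  filter_upwards [hmart.submartingale.ae_tendsto_limitProcess hbdd] with ω hω
  exact tendsto_average_of_tendsto_sum_div hω

/-! ### Pointwise inequalities for powers and reciprocals -/

lemma rpow_le_one_add_rpow {s r q : ℝ} (hs : 0 ≤ s) (hr : 0 ≤ r) (hrq : r ≤ q) :
    s ^ r ≤ 1 + s ^ q := by
  rcases le_total s 1 with h | h
  · linarith [Real.rpow_le_one hs h hr, Real.rpow_nonneg hs q]
  · linarith [Real.rpow_le_rpow_of_exponent_le h hrq]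

/-- The graph of `x ↦ x ^ (1 + β)` lies above its tangents. -/
lemma mul_rpow_mul_sub_le_rpow_sub_rpow {x y β : ℝ} (hx : 0 < x) (hy : 0 ≤ y) (hβ : 0 ≤ β) :
    (1 + β) * x ^ β * (y - x) ≤ y ^ (1 + β) - x ^ (1 + β) := by
  have h := one_add_mul_self_le_rpow_one_add (s := y / x - 1) (p := 1 + β)
    (by linarith [div_nonneg hy hx.le]) (by linarith)
  rw [add_sub_cancel, Real.div_rpow hy hx.le, le_div_iff₀ (Real.rpow_pos_of_pos hx _)] at h
  have e : x ^ (1 + β) = x * x ^ β := by rw [Real.rpow_add hx, Real.rpow_one]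
  have e2 : (1 + (1 + β) * (y / x - 1)) * x ^ (1 + β)
      = x ^ (1 + β) + (1 + β) * x ^ β * (y - x) := by
    rw [e]; field_simp
  linarith

/-- Write y^(1+β) = y · y^β and apply Bernoulli's inequality for the concave power (y/x)^β. The
bound holds however far y is from x. -/
lemma rpow_sub_rpow_le_tangent_add_sq {x y β : ℝ} (hx : 0 < x) (hy : 0 ≤ y) (hβ : 0 ≤ β)
    (hβ1 : β ≤ 1) :
    y ^ (1 + β) - x ^ (1 + β) ≤ (1 + β) * x ^ β * (y - x) + β * x ^ (β - 1) * (y - x) ^ 2 := by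
  have h := rpow_one_add_le_one_add_mul_self (s := y / x - 1) (p := β)
    (by linarith [div_nonneg hy hx.le]) hβ hβ1
  rw [add_sub_cancel, Real.div_rpow hy hx.le, div_le_iff₀ (Real.rpow_pos_of_pos hx _)] at h
  have e : x ^ (1 + β) = x * x ^ β := by rw [Real.rpow_add hx, Real.rpow_one]
  have e' : y ^ (1 + β) = y * y ^ β := by
    rw [Real.rpow_add' hy (by positivity), Real.rpow_one]
  have e2 : x ^ (β - 1) = x ^ β / x := by rw [Real.rpow_sub hx, Real.rpow_one]
  have h2 := mul_le_mul_of_nonneg_left h hy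
  have e3 : y * ((1 + β * (y / x - 1)) * x ^ β) = x * x ^ β + ((1 + β) * x ^ β * (y - x)
      + β * (x ^ β / x) * (y - x) ^ 2) := by
    field_simp; ring
  rw [e, e', e2]
  linarith

/-- The tangent inequalities at both ends bound the difference, and y^β ≤ x^β + |y-x|^β by
subadditivity. The last term is why moments of order 2+2β are needed. -/
lemma sq_rpow_sub_rpow_le {x y β : ℝ} (hx : 0 < x) (hy : 0 < y) (hβ : 0 ≤ β) (hβ1 : β ≤ 1) :
    (y ^ (1 + β) - x ^ (1 + β)) ^ 2
      ≤ 8 * ((x ^ β) ^ 2 * (y - x) ^ 2 + |y - x| ^ (2 + 2 * β)) := by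
  set s := |y - x| with hs
  have hs0 : 0 ≤ s := abs_nonneg _
  have hxb := Real.rpow_nonneg hx.le β
  have hsb := Real.rpow_nonneg hs0 β
  have hyb : y ^ β ≤ x ^ β + s ^ β := by
    refine (Real.rpow_le_rpow hy.le ?_ hβ).trans (Real.rpow_add_le_add_rpow hx.le hs0 hβ hβ1)
    linarith [le_abs_self (y - x)]
  have e : s ^ (2 + 2 * β) = (s * s ^ β) ^ 2 := by
    rw [← Real.rpow_one_add' hs0 (by positivity), ← Real.rpow_natCast, ← Real.rpow_mul hs0]
    congr 1; push_cast; ring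
  have key : |y ^ (1 + β) - x ^ (1 + β)| ≤ 2 * (x ^ β * s + s * s ^ β) := by
    have h1 := mul_rpow_mul_sub_le_rpow_sub_rpow hx hy.le hβ
    have h2 := mul_rpow_mul_sub_le_rpow_sub_rpow hy hx.le hβ
    have h3 : y - x ≤ s := le_abs_self _
    have h4 : -s ≤ y - x := neg_abs_le _
    have h5 : y ^ β * (y - x) ≤ (x ^ β + s ^ β) * s :=
      (mul_le_mul_of_nonneg_left h3 (Real.rpow_nonneg hy.le _)).trans
        (mul_le_mul_of_nonneg_right hyb hs0)
    have h6 : x ^ β * (-s) ≤ x ^ β * (y - x) := mul_le_mul_of_nonneg_left h4 hxb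
    have h7 : 0 ≤ x ^ β * s := by positivity
    have h8 : 0 ≤ s * s ^ β := by positivity
    rw [abs_le]
    constructor <;> nlinarith
  rw [e, ← sq_abs (y - x), ← sq_abs (y ^ (1 + β) - x ^ (1 + β)), ← hs]
  calc |y ^ (1 + β) - x ^ (1 + β)| ^ 2 ≤ (2 * (x ^ β * s + s * s ^ β)) ^ 2 := by gcongr
    _ ≤ _ := by nlinarith [sq_nonneg (x ^ β * s - s * s ^ β)]

/-- The exact remainder is (y-x)² / (x² y). If y ≥ x/2, then 1/y ≤ 2/x. Otherwise the jump is at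
least x/2, so the factor (2|y-x|/x)^(γ-2) ≥ 1 may be inserted. -/
lemma inv_sub_inv_le {x y γ : ℝ} (hx : 1 ≤ x) (hy : 1 ≤ y) (hγ : 2 ≤ γ) :
    1 / y - 1 / x ≤ -(1 / x ^ 2) * (y - x)
      + 1 / x ^ 2 * (2 / x + (2 / x) ^ (γ - 2)) * (1 + |y - x| ^ γ) := by
  have hx0 : 0 < x := by linarith
  have hy0 : 0 < y := by linarith
  have e : 1 / y - 1 / x = -(1 / x ^ 2) * (y - x) + 1 / x ^ 2 * ((y - x) ^ 2 / y) := by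
    field_simp; ring
  rw [e, mul_assoc]
  gcongr
  set s := |y - x| with hs
  have hs0 : 0 ≤ s := abs_nonneg _
  have hsg := Real.rpow_nonneg hs0 γ
  have h2x : 0 ≤ (2 / x) ^ (γ - 2) := by positivity
  have hs2 : (y - x) ^ 2 ≤ 1 + s ^ γ := by
    rw [← sq_abs, ← hs, ← Real.rpow_natCast]
    exact rpow_le_one_add_rpow hs0 (by simp) (by simpa using hγ)
  rcases le_total (x / 2) y with h | h
  · calc (y - x) ^ 2 / y ≤ (1 + s ^ γ) / (x / 2) := by gcongr
      _ = 2 / x * (1 + s ^ γ) := by field_simp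
      _ ≤ _ := by nlinarith
  · have hsx : x / 2 ≤ s := by
      have := neg_abs_le (y - x)
      linarith
    have hspos : 0 < s := by linarith
    have h1 : 1 ≤ (2 / x) ^ (γ - 2) * s ^ (γ - 2) := by
      rw [← Real.mul_rpow (by positivity) hs0]
      refine Real.one_le_rpow ?_ (by linarith)
      rw [div_mul_eq_mul_div, le_div_iff₀ hx0]; linarith
    have e2 : s ^ γ = s ^ (γ - 2) * s ^ 2 := by
      rw [← Real.rpow_natCast, ← Real.rpow_add hspos]; congr 1; push_cast; ring
    calc (y - x) ^ 2 / y ≤ (y - x) ^ 2 := div_le_self (sq_nonneg _) hy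
      _ = s ^ 2 := by rw [hs, sq_abs]
      _ ≤ ((2 / x) ^ (γ - 2) * s ^ (γ - 2)) * s ^ 2 := le_mul_of_one_le_left (sq_nonneg _) h1
      _ = (2 / x) ^ (γ - 2) * s ^ γ := by rw [e2]; ring
      _ ≤ _ := by
        have : 0 ≤ 2 / x := by positivity
        nlinarith

/-! ### Conditional moments of the increments -/

/-- If `G ≤ a D + b V` with `a`, `b` known to `m'`, then
`E[G | m'] ≤ a E[D | m'] + b E[V | m']`. -/
lemma condExp_le_of_le_mul_add_mul {Ω : Type*} {m' m : MeasurableSpace Ω} {P : Measure Ω}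
    [IsProbabilityMeasure P] {G D V a b : Ω → ℝ}
    (hG : Integrable G P) (hD : Integrable D P) (hV : Integrable V P)
    (ha : StronglyMeasurable[m'] a) (hb : StronglyMeasurable[m'] b)
    (haD : Integrable (a * D) P) (hbV : Integrable (b * V) P)
    (h : ∀ ω, G ω ≤ a ω * D ω + b ω * V ω) :
    ∀ᵐ ω ∂P, (P[G | m']) ω ≤ a ω * (P[D | m']) ω + b ω * (P[V | m']) ω := by
  have h1 := condExp_mono (m := m') hG (haD.add hbV) (Eventually.of_forall h)
  have h2 := condExp_add haD hbV m'
  filter_upwards [h1, h2, condExp_mul_of_stronglyMeasurable_left ha haD hD,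
    condExp_mul_of_stronglyMeasurable_left hb hbV hV] with ω h1 h2 h3 h4
  rw [h2, Pi.add_apply, h3, h4] at h1
  exact h1

/-- An adapted process with values in `[1,∞)`, in `L^(2+2β)`, whose increments have uniformly
bounded conditional `γ`-moments. -/
structure HasIncrementMoments {Ω : Type*} {m : MeasurableSpace Ω} (P : Measure Ω)
    (F : Filtration ℕ m) (U : ℕ → Ω → ℝ) (β γ B : ℝ) : Prop where
  beta_nonneg : 0 ≤ β
  beta_lt : β < 1
  lt_gamma : 2 + 2 * β < γ
  one_le : ∀ t ω, 1 ≤ U t ω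
  adapted : ∀ t, StronglyMeasurable[F t] (U t)
  memLp : ∀ t, MemLp (U t) (ENNReal.ofReal (2 + 2 * β)) P
  moment : IncrementMomentBound P F U γ B

section

variable {Ω : Type*} {m : MeasurableSpace Ω} {P : Measure Ω}
  {F : Filtration ℕ m} {U : ℕ → Ω → ℝ} {β γ B : ℝ}

lemma MeasureTheory.MemLp.rpow_one_add_memLp_two {g : Ω → ℝ} (hβ : 0 ≤ β)
    (hg : MemLp g (ENNReal.ofReal (2 + 2 * β)) P) (h0 : ∀ ω, 0 ≤ g ω) :
    MemLp (fun ω => g ω ^ (1 + β)) 2 P := by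
  have hm : AEStronglyMeasurable (fun ω => g ω ^ (1 + β)) P :=
    (hg.1.aemeasurable.pow_const _).aestronglyMeasurable
  rw [memLp_two_iff_integrable_sq hm]
  have h := hg.integrable_norm_rpow (by simp; linarith) (by simp)
  rw [ENNReal.toReal_ofReal (by linarith)] at h
  refine h.congr (Eventually.of_forall fun ω => ?_)
  simp only [Real.norm_of_nonneg (h0 ω)]
  rw [← Real.rpow_natCast, ← Real.rpow_mul (h0 ω)]
  congr 1; push_cast; ring

namespace HasIncrementMoments

lemma pos (h : HasIncrementMoments P F U β γ B) (t : ℕ) (ω : Ω) : 0 < U t ω :=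
  zero_lt_one.trans_le (h.one_le t ω)

lemma memLp_increment (h : HasIncrementMoments P F U β γ B) (t : ℕ) :
    MemLp (fun ω => U (t + 1) ω - U t ω) (ENNReal.ofReal (2 + 2 * β)) P :=
  (h.memLp (t + 1)).sub (h.memLp t)

lemma two_le_exponent (h : HasIncrementMoments P F U β γ B) :
    (2 : ENNReal) ≤ ENNReal.ofReal (2 + 2 * β) := by
  rw [← ENNReal.ofReal_ofNat]
  exact ENNReal.ofReal_le_ofReal (by linarith [h.beta_nonneg])

lemma measurable (h : HasIncrementMoments P F U β γ B) (t : ℕ) : Measurable[F t] (U t) :=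
  (h.adapted t).measurable

lemma stronglyMeasurable_comp (h : HasIncrementMoments P F U β γ B) (t : ℕ) {g : ℝ → ℝ}
    (hg : Measurable g) : StronglyMeasurable[F t] (fun ω => g (U t ω)) :=
  (hg.comp (h.measurable t)).stronglyMeasurable

lemma memLp_two_rpow (h : HasIncrementMoments P F U β γ B) (t : ℕ) :
    MemLp (fun ω => U t ω ^ (1 + β)) 2 P :=
  (h.memLp t).rpow_one_add_memLp_two h.beta_nonneg fun ω => (h.pos t ω).le

lemma aestronglyMeasurable_comp (h : HasIncrementMoments P F U β γ B) (t : ℕ) {g : ℝ → ℝ}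
    (hg : Measurable g) : AEStronglyMeasurable (fun ω => g (U t ω)) P :=
  ((h.stronglyMeasurable_comp t hg).mono (F.le t)).aestronglyMeasurable

variable [IsProbabilityMeasure P]

lemma memLp_two (h : HasIncrementMoments P F U β γ B) (t : ℕ) : MemLp (U t) 2 P :=
  (h.memLp t).mono_exponent h.two_le_exponent

lemma memLp_two_increment (h : HasIncrementMoments P F U β γ B) (t : ℕ) :
    MemLp (fun ω => U (t + 1) ω - U t ω) 2 P :=
  (h.memLp_increment t).mono_exponent h.two_le_exponent

lemma integrable_increment (h : HasIncrementMoments P F U β γ B) (t : ℕ) :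
    Integrable (fun ω => U (t + 1) ω - U t ω) P :=
  (h.memLp_two_increment t).integrable one_le_two

lemma integrable_moment (h : HasIncrementMoments P F U β γ B) (t : ℕ) :
    Integrable (fun ω => 1 + |U (t + 1) ω - U t ω| ^ γ) P :=
  (integrable_const 1).add (h.moment t).1

lemma condExp_moment_le (h : HasIncrementMoments P F U β γ B) (t : ℕ) :
    ∀ᵐ ω ∂P, (P[fun ω => 1 + |U (t + 1) ω - U t ω| ^ γ | F t]) ω ≤ 1 + |B| := by
  have h1 := condExp_add (integrable_const (1 : ℝ)) (h.moment t).1 (F t) (μ := P)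
  filter_upwards [h1, (h.moment t).2] with ω h1 h2
  rw [Pi.add_apply, condExp_const (F.le t)] at h1
  refine h1.le.trans ?_
  linarith [le_abs_self B]

lemma condExp_le_of_le_moment (h : HasIncrementMoments P F U β γ B) (t : ℕ) {G : Ω → ℝ}
    (hG : Integrable G P) (hle : ∀ ω, G ω ≤ 1 + |U (t + 1) ω - U t ω| ^ γ) :
    ∀ᵐ ω ∂P, (P[G | F t]) ω ≤ 1 + |B| := by
  filter_upwards [condExp_mono (m := F t) hG (h.integrable_moment t) (Eventually.of_forall hle),
    h.condExp_moment_le t] with ω h1 h2 using h1.trans h2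

/-- Dominate by (U + |ΔU|)^(1+β), which is in L² because U and ΔU are in L^(2+2β). -/
lemma memLp_rpow_mul_increment (h : HasIncrementMoments P F U β γ B) (t : ℕ) :
    MemLp (fun ω => U t ω ^ β * (U (t + 1) ω - U t ω)) 2 P := by
  have h1 : MemLp (fun ω => U t ω + |U (t + 1) ω - U t ω|) (ENNReal.ofReal (2 + 2 * β)) P :=
    (h.memLp t).add (h.memLp_increment t).norm
  have h2 := h1.rpow_one_add_memLp_two h.beta_nonneg
    fun ω => add_nonneg (h.pos t ω).le (abs_nonneg _)
  refine h2.mono ((h.aestronglyMeasurable_comp t (by fun_prop : Measurable fun x : ℝ => x ^ β)).mul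
    (h.integrable_increment t).1) (Eventually.of_forall fun ω => ?_)
  have hx := h.pos t ω
  have hs := abs_nonneg (U (t + 1) ω - U t ω)
  rw [norm_mul, Real.norm_eq_abs, Real.norm_eq_abs, Real.norm_eq_abs,
    abs_of_nonneg (Real.rpow_nonneg hx.le _), abs_of_nonneg (Real.rpow_nonneg (by positivity) _),
    add_comm 1 β, Real.rpow_add_one (by positivity)]
  gcongr
  · exact h.beta_nonneg
  · linarith
  · linarith

/-! ### Transience -/

/-- Under a positive drift of order at least `x ^ (-β)`, an unbounded process is transient. -/
theorem ae_tendsto_atTop (h : HasIncrementMoments P F U β γ B)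
    {c x₁ : ℝ} (hc : 0 < c)
    (hlow : ∀ t, ∀ᵐ ω ∂P, x₁ ≤ U t ω → c ≤ U t ω ^ β * meanDrift P F U t ω)
    (hunb : ∀ᵐ ω ∂P, ∀ K : ℝ, ∃ᶠ t in atTop, K < U t ω) :
    ∀ᵐ ω ∂P, Tendsto (fun t => U t ω) atTop atTop := by
  -- The remainder in `inv_sub_inv_le` is negligible against a drift c x^(-β): the exponents β-1 and
  -- β-(γ-2) are both negative.
  have hlim : Tendsto (fun x : ℝ => x ^ β * ((2 / x + (2 / x) ^ (γ - 2)) * (1 + |B|)))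
      atTop (nhds 0) := by
    have h1 : Tendsto (fun x : ℝ => x ^ (-(1 - β))) atTop (nhds 0) :=
      tendsto_rpow_neg_atTop (by linarith [h.beta_lt])
    have h2 : Tendsto (fun x : ℝ => x ^ (-(γ - 2 - β))) atTop (nhds 0) :=
      tendsto_rpow_neg_atTop (by linarith [h.lt_gamma, h.beta_nonneg])
    have h3 := ((h1.const_mul 2).add (h2.const_mul (2 ^ (γ - 2)))).mul_const (1 + |B|)
    simp only [mul_zero, add_zero, zero_mul] at h3
    refine h3.congr' ?_
    filter_upwards [eventually_gt_atTop 0] with x hx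
    rw [Real.div_rpow (by norm_num) hx.le, neg_sub, neg_sub, Real.rpow_sub hx, Real.rpow_sub hx,
      Real.rpow_one]
    ring
  obtain ⟨K, hK⟩ := eventually_atTop.1 ((hlim.eventually_le_const hc).and
    ((eventually_ge_atTop x₁).and (eventually_ge_atTop 1)))
  have hK1 : 1 ≤ K := (hK K le_rfl).2.2
  have hK0 : 0 < K := by linarith
  -- Truncation makes the supermartingale property automatic when U ≤ K, where W already has its
  -- maximal value 1/K. The drift is used only when U ≥ K.
  set W : ℕ → Ω → ℝ := fun t ω => min (1 / U t ω) (1 / K) with hW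
  have hW0 : ∀ t ω, 0 ≤ W t ω := fun t ω =>
    le_min (by have := h.pos t ω; positivity) (by positivity)
  have hW1 : ∀ t ω, W t ω ≤ 1 := fun t ω =>
    (min_le_right _ _).trans (by rw [div_le_one hK0]; exact hK1)
  have hWm : ∀ t, StronglyMeasurable[F t] (W t) := fun t =>
    h.stronglyMeasurable_comp t (by fun_prop : Measurable fun x : ℝ => min (1 / x) (1 / K))
  have hWi : ∀ t, Integrable (W t) P := fun t =>
    Integrable.of_bound ((hWm t).mono (F.le t)).aestronglyMeasurable 1
      (Eventually.of_forall fun ω => by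
        rw [Real.norm_of_nonneg (hW0 t ω)]; exact hW1 t ω)
  have hinv : ∀ t, Integrable (fun ω => 1 / U t ω) P := fun t =>
    Integrable.of_bound (h.aestronglyMeasurable_comp t
      (by fun_prop : Measurable fun x : ℝ => 1 / x)) 1
      (Eventually.of_forall fun ω => by
        rw [Real.norm_of_nonneg (by have := h.pos t ω; positivity), div_le_one (h.pos t ω)]
        exact h.one_le t ω)
  have hsuper : Supermartingale W F P := by
    refine supermartingale_nat hWm hWi fun t => ?_
    have ham : Measurable fun x : ℝ => -(1 / x ^ 2) := by fun_prop
    have hbm : Measurable fun x : ℝ => 1 / x ^ 2 * (2 / x + (2 / x) ^ (γ - 2)) := by fun_prop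
    have hsq : ∀ ω, 1 / U t ω ^ 2 ≤ 1 := fun ω => by
      rw [div_le_one (by have := h.pos t ω; positivity)]
      exact one_le_pow₀ (h.one_le t ω)
    have haD : Integrable ((fun ω => -(1 / U t ω ^ 2)) * fun ω => U (t + 1) ω - U t ω) P :=
      (h.integrable_increment t).bdd_mul (c := 1) (h.aestronglyMeasurable_comp t ham)
        (Eventually.of_forall fun ω => by
          rw [norm_neg, Real.norm_of_nonneg (by positivity)]; exact hsq ω)
    have hbV : Integrable ((fun ω => 1 / U t ω ^ 2 * (2 / U t ω + (2 / U t ω) ^ (γ - 2)))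
        * fun ω => 1 + |U (t + 1) ω - U t ω| ^ γ) P :=
      (h.integrable_moment t).bdd_mul (c := 1 * (2 + 2 ^ (γ - 2)))
        (h.aestronglyMeasurable_comp t hbm)
        (Eventually.of_forall fun ω => by
          have hx := h.pos t ω
          have h2 : 2 / U t ω ≤ 2 := div_le_self (by norm_num) (h.one_le t ω)
          have := hsq ω
          rw [Real.norm_of_nonneg (by positivity)]
          gcongr
          linarith [h.lt_gamma, h.beta_nonneg])
    have key := condExp_le_of_le_mul_add_mul (m' := F t)
      (G := fun ω => 1 / U (t + 1) ω - 1 / U t ω)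
      ((hinv (t + 1)).sub (hinv t)) (h.integrable_increment t) (h.integrable_moment t)
      (h.stronglyMeasurable_comp t ham) (h.stronglyMeasurable_comp t hbm) haD hbV
      (fun ω => inv_sub_inv_le (h.one_le t ω) (h.one_le (t + 1) ω)
        (by linarith [h.lt_gamma, h.beta_nonneg]))
    have hsub := condExp_sub (hinv (t + 1)) (hinv t) (F t)
    have hself := condExp_of_stronglyMeasurable (F.le t)
      (h.stronglyMeasurable_comp t (by fun_prop : Measurable fun x : ℝ => 1 / x)) (hinv t)
    have hm1 := condExp_mono (m := F t) (hWi (t + 1)) (hinv (t + 1))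
      (Eventually.of_forall fun ω => min_le_left _ _)
    have hm2 := condExp_mono (m := F t) (hWi (t + 1)) (integrable_const (1 / K))
      (Eventually.of_forall fun ω => min_le_right _ _)
    filter_upwards [key, hsub, hm1, hm2, hlow t, h.condExp_moment_le t]
      with ω key hsub hm1 hm2 hlow hmom
    rw [condExp_const (F.le t)] at hm2
    rw [Pi.sub_apply, hself] at hsub
    refine le_min ?_ hm2
    rcases le_total K (U t ω) with hKU | hUK
    · refine hm1.trans ?_
      have hk := hK _ hKU
      have hd := hlow hk.2.1
      have hx := h.pos t ω
      have hxb := Real.rpow_pos_of_pos hx β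
      have hle : (2 / U t ω + (2 / U t ω) ^ (γ - 2)) * (1 + |B|) ≤ meanDrift P F U t ω :=
        le_of_mul_le_mul_left (hk.1.trans hd) hxb
      have hle2 : (2 / U t ω + (2 / U t ω) ^ (γ - 2)) *
          (P[fun ω => 1 + |U (t + 1) ω - U t ω| ^ γ | F t]) ω ≤ meanDrift P F U t ω :=
        (mul_le_mul_of_nonneg_left hmom (by positivity)).trans hle
      have hle3 := mul_le_mul_of_nonneg_left hle2 (by positivity : 0 ≤ 1 / U t ω ^ 2)
      have e : (P[fun ω => 1 / U (t + 1) ω - 1 / U t ω | F t]) ω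
          = (P[fun ω => 1 / U (t + 1) ω | F t]) ω - 1 / U t ω := hsub
      rw [e] at key
      change _ ≤ -(1 / U t ω ^ 2) * meanDrift P F U t ω + _ at key
      rw [mul_assoc] at key
      linarith
    · exact hm2.trans (one_div_le_one_div_of_le (h.pos t ω) hUK)
  have hconv := hsuper.neg.ae_tendsto_limitProcess (R := 1) fun n => by
    refine (eLpNorm_le_of_ae_bound (C := 1) (Eventually.of_forall fun ω => ?_)).trans ?_
    · rw [Pi.neg_apply, Pi.neg_apply, norm_neg, Real.norm_of_nonneg (hW0 n ω)]
      exact hW1 n ω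
    · simp
  filter_upwards [hconv, hunb] with ω hω hfreq
  obtain ⟨L, hlimW⟩ : ∃ L, Tendsto (fun t => W t ω) atTop (nhds L) :=
    ⟨_, by simpa only [Pi.neg_apply, neg_neg] using hω.neg⟩
  have hL0 : L ≤ 0 := by
    refine le_of_forall_pos_le_add fun ε hε => ?_
    rw [zero_add]
    by_contra hlt
    have hev := hlimW.eventually_const_lt (not_le.1 hlt)
    obtain ⟨t, ht1, ht2⟩ := ((hfreq (1 / ε)).and_eventually hev).exists
    have h3 : 1 / U t ω < ε := by
      rw [div_lt_comm₀ (h.pos t ω) hε]; exact ht1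
    exact absurd (ht2.trans_le (min_le_left _ _)) (not_lt.2 h3.le)
  rw [tendsto_atTop]
  intro M
  -- Once W is below this level, the minimum cannot be 1/K, so it is 1/U and U exceeds M.
  have hpos : 0 < 1 / max K M := by
    have : 0 < max K M := hK0.trans_le (le_max_left _ _)
    positivity
  filter_upwards [hlimW.eventually_lt_const (hL0.trans_lt hpos)] with t ht
  rcases min_lt_iff.1 ht with h1 | h1
  · exact (le_max_right _ _).trans
      ((one_div_lt_one_div (h.pos t ω) (hK0.trans_le (le_max_left _ _))).1 h1).le
  · exact absurd ((one_div_lt_one_div hK0 (hK0.trans_le (le_max_left _ _))).1 h1)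
      (not_lt.2 (le_max_left _ _))

end HasIncrementMoments
end

/-! ### Drift and variance of U^(1+β), and its linear growth -/

section

variable {Ω : Type*} {m : MeasurableSpace Ω} {P : Measure Ω}
  {F : Filtration ℕ m} {U : ℕ → Ω → ℝ} {β γ B : ℝ}

namespace HasIncrementMoments

lemma sq_increment_le (h : HasIncrementMoments P F U β γ B) (t : ℕ) (ω : Ω) :
    (U (t + 1) ω - U t ω) ^ 2 ≤ 1 + |U (t + 1) ω - U t ω| ^ γ := by
  rw [← sq_abs, ← Real.rpow_natCast]
  refine rpow_le_one_add_rpow (abs_nonneg _) (by simp) ?_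
  push_cast
  linarith [h.lt_gamma, h.beta_nonneg]

lemma rpow_sub_one_le_one (h : HasIncrementMoments P F U β γ B) (t : ℕ) (ω : Ω) :
    U t ω ^ (β - 1) ≤ 1 :=
  Real.rpow_le_one_of_one_le_of_nonpos (h.one_le t ω) (by linarith [h.beta_lt])

lemma memLp_two_rpow_increment (h : HasIncrementMoments P F U β γ B) (t : ℕ) :
    MemLp (fun ω => U (t + 1) ω ^ (1 + β) - U t ω ^ (1 + β)) 2 P :=
  (h.memLp_two_rpow (t + 1)).sub (h.memLp_two_rpow t)

variable [IsProbabilityMeasure P]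

lemma integrable_rpow (h : HasIncrementMoments P F U β γ B) (t : ℕ) :
    Integrable (fun ω => U t ω ^ (1 + β)) P :=
  (h.memLp_two_rpow t).integrable one_le_two

/-- The drift of `U ^ (1 + β)` is `(1 + β) U ^ β` times the drift of `U`, up to an error of order
`U ^ (β - 1)`. -/
lemma condExp_rpow_increment_bounds (h : HasIncrementMoments P F U β γ B) (t : ℕ) :
    ∀ᵐ ω ∂P, (1 + β) * (U t ω ^ β * meanDrift P F U t ω)
        ≤ (P[fun ω => U (t + 1) ω ^ (1 + β) - U t ω ^ (1 + β) | F t]) ω ∧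
      (P[fun ω => U (t + 1) ω ^ (1 + β) - U t ω ^ (1 + β) | F t]) ω
        ≤ (1 + β) * (U t ω ^ β * meanDrift P F U t ω) + U t ω ^ (β - 1) * (1 + |B|) := by
  have hG := (h.memLp_two_rpow_increment t).integrable one_le_two
  have ham : Measurable fun x : ℝ => (1 + β) * x ^ β := by fun_prop
  have ham' : Measurable fun x : ℝ => -((1 + β) * x ^ β) := by fun_prop
  have hbm : Measurable fun x : ℝ => x ^ (β - 1) := by fun_prop
  have hxD := (h.memLp_rpow_mul_increment t).integrable one_le_two
  have haD : Integrable ((fun ω => (1 + β) * U t ω ^ β) * fun ω => U (t + 1) ω - U t ω) P :=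
    (hxD.const_mul (1 + β)).congr (Eventually.of_forall fun ω => by simp [mul_assoc])
  have haD' : Integrable ((fun ω => -((1 + β) * U t ω ^ β)) * fun ω => U (t + 1) ω - U t ω) P :=
    haD.neg.congr (Eventually.of_forall fun ω => by simp)
  have hbV : Integrable ((fun ω => U t ω ^ (β - 1))
      * fun ω => 1 + |U (t + 1) ω - U t ω| ^ γ) P :=
    (h.integrable_moment t).bdd_mul (c := 1) (h.aestronglyMeasurable_comp t hbm)
      (Eventually.of_forall fun ω => by
        rw [Real.norm_of_nonneg (Real.rpow_nonneg (h.pos t ω).le _)]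
        exact h.rpow_sub_one_le_one t ω)
  have hup := condExp_le_of_le_mul_add_mul (m' := F t) hG (h.integrable_increment t)
    (h.integrable_moment t) (h.stronglyMeasurable_comp t ham) (h.stronglyMeasurable_comp t hbm)
    haD hbV fun ω => by
      have h1 := rpow_sub_rpow_le_tangent_add_sq (h.pos t ω) (h.pos (t + 1) ω).le h.beta_nonneg
        h.beta_lt.le
      have h2 := Real.rpow_nonneg (h.pos t ω).le (β - 1)
      have h3 : β * U t ω ^ (β - 1) * (U (t + 1) ω - U t ω) ^ 2
          ≤ U t ω ^ (β - 1) * (1 + |U (t + 1) ω - U t ω| ^ γ) := by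
        gcongr
        · exact mul_le_of_le_one_left h2 h.beta_lt.le
        · exact h.sq_increment_le t ω
      exact h1.trans (by linarith)
  -- By convexity the lower bound has no error term, hence `V = 0` and `b = 0`.
  have hlo := condExp_le_of_le_mul_add_mul (m' := F t) (V := 0) (b := 0) hG.neg
    (h.integrable_increment t) (integrable_zero _ _ _) (h.stronglyMeasurable_comp t ham')
    stronglyMeasurable_zero haD' (by simp) fun ω => by
      have h1 := mul_rpow_mul_sub_le_rpow_sub_rpow (h.pos t ω) (h.pos (t + 1) ω).le h.beta_nonneg
      simp only [Pi.neg_apply, Pi.zero_apply, mul_zero, add_zero, neg_mul]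
      exact neg_le_neg h1
  filter_upwards [hup, hlo, h.condExp_moment_le t,
    condExp_neg (μ := P) (fun ω => U (t + 1) ω ^ (1 + β) - U t ω ^ (1 + β)) (F t)]
    with ω hup hlo hmom hneg
  constructor
  · rw [hneg] at hlo
    simp only [Pi.neg_apply, Pi.zero_apply, zero_mul, add_zero, neg_mul] at hlo
    rw [← mul_assoc]
    exact neg_le_neg_iff.1 hlo
  · rw [← mul_assoc]
    refine hup.trans (add_le_add le_rfl ?_)
    exact mul_le_mul_of_nonneg_left hmom (Real.rpow_nonneg (h.pos t ω).le _)

/-- The conditional drift of U^(1+β) is bounded above everywhere: by hypothesis when U ≥ x₁, and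
otherwise because U^β ≤ |x₁|^β and the increment moments control the drift. -/
lemma exists_integral_rpow_le (h : HasIncrementMoments P F U β γ B) {c x₁ : ℝ}
    (hup : ∀ t, ∀ᵐ ω ∂P, x₁ ≤ U t ω → U t ω ^ β * meanDrift P F U t ω ≤ c) :
    ∃ C : ℝ, ∀ t : ℕ, ∫ ω, U t ω ^ (1 + β) ∂P ≤ C * ((t : ℝ) + 1) := by
  set K : ℝ := |c| + |x₁| ^ β * (1 + |B|) with hK
  have hK0 : 0 ≤ K := by positivity
  set R : ℝ := (1 + β) * K + (1 + |B|) with hR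
  have hβ := h.beta_nonneg
  have hR0 : 0 ≤ R := by positivity
  have hstep : ∀ t, ∫ ω, U (t + 1) ω ^ (1 + β) ∂P ≤ ∫ ω, U t ω ^ (1 + β) ∂P + R := by
    intro t
    have hae : ∀ᵐ ω ∂P,
        (P[fun ω => U (t + 1) ω ^ (1 + β) - U t ω ^ (1 + β) | F t]) ω ≤ R := by
      have hd := h.condExp_le_of_le_moment t (h.integrable_increment t) fun ω =>
        (le_abs_self _).trans (by
          have := rpow_le_one_add_rpow (abs_nonneg (U (t + 1) ω - U t ω)) zero_le_one
            (by linarith [h.lt_gamma] : (1 : ℝ) ≤ γ)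
          rwa [Real.rpow_one] at this)
      filter_upwards [h.condExp_rpow_increment_bounds t, hup t, hd] with ω h1 h2 h3
      refine h1.2.trans (add_le_add (mul_le_mul_of_nonneg_left ?_ (by positivity)) ?_)
      · have hpos : 0 ≤ |x₁| ^ β * (1 + |B|) := by positivity
        rcases le_total x₁ (U t ω) with hx | hx
        · linarith [h2 hx, le_abs_self c]
        · have hx2 : U t ω ^ β ≤ |x₁| ^ β :=
            Real.rpow_le_rpow (h.pos t ω).le (hx.trans (le_abs_self _)) hβ
          have hx3 : U t ω ^ β * meanDrift P F U t ω ≤ U t ω ^ β * (1 + |B|) :=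
            mul_le_mul_of_nonneg_left h3 (Real.rpow_nonneg (h.pos t ω).le _)
          have hx4 := mul_le_mul_of_nonneg_right hx2 (by positivity : 0 ≤ 1 + |B|)
          linarith [abs_nonneg c]
      · exact mul_le_of_le_one_left (by positivity) (h.rpow_sub_one_le_one t ω)
    have h1 := integral_mono_ae integrable_condExp (integrable_const R) hae
    rw [integral_condExp (F.le t), integral_sub (h.integrable_rpow (t + 1)) (h.integrable_rpow t)]
      at h1
    simp only [integral_const, probReal_univ, smul_eq_mul, one_mul] at h1
    linarith
  have h0 : 0 ≤ ∫ ω, U 0 ω ^ (1 + β) ∂P :=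
    integral_nonneg fun ω => Real.rpow_nonneg (h.pos 0 ω).le _
  refine ⟨∫ ω, U 0 ω ^ (1 + β) ∂P + R, fun t => ?_⟩
  induction t with
  | zero => simpa using hR0
  | succ t ih =>
    refine (hstep t).trans ?_
    push_cast
    nlinarith

lemma integrable_rpow_sq (h : HasIncrementMoments P F U β γ B) (t : ℕ) :
    Integrable (fun ω => (U t ω ^ β) ^ 2) P := by
  refine (h.memLp_two t).integrable_sq.mono' (h.aestronglyMeasurable_comp t
    (by fun_prop : Measurable fun x : ℝ => (x ^ β) ^ 2)) (Eventually.of_forall fun ω => ?_)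
  rw [Real.norm_of_nonneg (sq_nonneg _)]
  have h1 := Real.rpow_nonneg (h.pos t ω).le β
  gcongr
  exact Real.rpow_le_self_of_one_le (h.one_le t ω) h.beta_lt.le

/-- Condition `sq_rpow_sub_rpow_le` on the past. Since U ≥ 1, the bounded contribution of
|ΔU|^(2+2β) is absorbed into U^(2β). -/
lemma integral_sq_rpow_increment_le (h : HasIncrementMoments P F U β γ B) (t : ℕ) :
    ∫ ω, (U (t + 1) ω ^ (1 + β) - U t ω ^ (1 + β)) ^ 2 ∂P
      ≤ 16 * (1 + |B|) * ∫ ω, (U t ω ^ β) ^ 2 ∂P := by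
  have hG := (h.memLp_two_rpow_increment t).integrable_sq
  have ham : Measurable fun x : ℝ => 8 * (x ^ β) ^ 2 := by fun_prop
  have hxD := (h.memLp_rpow_mul_increment t).integrable_sq
  have haD : Integrable ((fun ω => 8 * (U t ω ^ β) ^ 2)
      * fun ω => (U (t + 1) ω - U t ω) ^ 2) P :=
    (hxD.const_mul 8).congr (Eventually.of_forall fun ω => by
      simp only [Pi.mul_apply]; ring)
  have hbV : Integrable ((fun _ => 8) * fun ω => 1 + |U (t + 1) ω - U t ω| ^ γ) P :=
    (h.integrable_moment t).const_mul 8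
  have key := condExp_le_of_le_mul_add_mul (m' := F t) hG (h.memLp_two_increment t).integrable_sq
    (h.integrable_moment t) (h.stronglyMeasurable_comp t ham) stronglyMeasurable_const haD hbV
    fun ω => by
      refine (sq_rpow_sub_rpow_le (h.pos t ω) (h.pos (t + 1) ω) h.beta_nonneg
        h.beta_lt.le).trans ?_
      have := rpow_le_one_add_rpow (abs_nonneg (U (t + 1) ω - U t ω))
        (by linarith [h.beta_nonneg] : 0 ≤ 2 + 2 * β) h.lt_gamma.le
      linarith
  have hsq := h.condExp_le_of_le_moment t (h.memLp_two_increment t).integrable_sq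
    (h.sq_increment_le t)
  have hae : ∀ᵐ ω ∂P,
      (P[fun ω => (U (t + 1) ω ^ (1 + β) - U t ω ^ (1 + β)) ^ 2 | F t]) ω
        ≤ 16 * (1 + |B|) * (U t ω ^ β) ^ 2 := by
    filter_upwards [key, hsq, h.condExp_moment_le t] with ω h1 h2 h3
    have h4 : 1 ≤ (U t ω ^ β) ^ 2 := one_le_pow₀ (Real.one_le_rpow (h.one_le t ω) h.beta_nonneg)
    have h5 := mul_le_mul_of_nonneg_left h2 (by positivity : 0 ≤ 8 * (U t ω ^ β) ^ 2)
    have h6 := mul_le_mul_of_nonneg_right h4 (by positivity : 0 ≤ 1 + |B|)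
    linarith
  have h1 := integral_mono_ae integrable_condExp
    ((h.integrable_rpow_sq t).const_mul (16 * (1 + |B|))) hae
  rwa [integral_condExp (F.le t), integral_const_mul] at h1

lemma summable_integral_sq_rpow_increment (h : HasIncrementMoments P F U β γ B) {c x₁ : ℝ}
    (hup : ∀ t, ∀ᵐ ω ∂P, x₁ ≤ U t ω → U t ω ^ β * meanDrift P F U t ω ≤ c) :
    Summable fun t : ℕ => (∫ ω, (U (t + 1) ω ^ (1 + β) - U t ω ^ (1 + β)) ^ 2 ∂P)
      / ((t : ℝ) + 1) ^ 2 := by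
  obtain ⟨C, hC⟩ := h.exists_integral_rpow_le hup
  have hβ := h.beta_nonneg
  set θ : ℝ := 2 * β / (1 + β) with hθ
  have hθ1 : θ < 1 := by
    rw [hθ, div_lt_one (by positivity)]; linarith [h.beta_lt]
  have hθ0 : 0 ≤ θ := by positivity
  have hbound : ∀ t : ℕ, ∫ ω, (U t ω ^ β) ^ 2 ∂P ≤ (1 + C) * ((t : ℝ) + 1) ^ θ := by
    intro t
    have ht : 0 < (t : ℝ) + 1 := by positivity
    -- A substitute for Jensen: with z = U^(1+β), the left side is z^θ, and θ < 1 gives a bound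
    -- affine in z on comparing z with t+1.
    have hpt : ∀ ω, (U t ω ^ β) ^ 2
        ≤ ((t : ℝ) + 1) ^ θ + ((t : ℝ) + 1) ^ (θ - 1) * U t ω ^ (1 + β) := by
      intro ω
      set z := U t ω ^ (1 + β) with hz
      have hz0 : 0 < z := Real.rpow_pos_of_pos (h.pos t ω) _
      have e : (U t ω ^ β) ^ 2 = z ^ θ := by
        rw [hz, ← Real.rpow_mul (h.pos t ω).le, ← Real.rpow_natCast,
          ← Real.rpow_mul (h.pos t ω).le]
        congr 1
        rw [hθ]; push_cast; field_simp
      rw [e]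
      rcases le_total z ((t : ℝ) + 1) with hle | hle
      · have h1 := Real.rpow_le_rpow hz0.le hle hθ0
        have h2 : 0 ≤ ((t : ℝ) + 1) ^ (θ - 1) * z := by positivity
        linarith
      · have h1 : z ^ (θ - 1) ≤ ((t : ℝ) + 1) ^ (θ - 1) :=
          Real.rpow_le_rpow_of_nonpos ht hle (by linarith)
        have h2 : z ^ θ = z ^ (θ - 1) * z := by
          rw [← Real.rpow_add_one hz0.ne']; ring_nf
        rw [h2]
        have h3 := mul_le_mul_of_nonneg_right h1 hz0.le
        have h4 : 0 ≤ ((t : ℝ) + 1) ^ θ := by positivity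
        linarith
    have h1 := integral_mono (h.integrable_rpow_sq t) ((integrable_const _).add
      ((h.integrable_rpow t).const_mul _)) hpt
    simp only [Pi.add_apply] at h1
    rw [integral_add (integrable_const _) ((h.integrable_rpow t).const_mul _),
      integral_const_mul] at h1
    simp only [integral_const, probReal_univ, smul_eq_mul, one_mul] at h1
    have h2 := mul_le_mul_of_nonneg_left (hC t)
      (by positivity : 0 ≤ ((t : ℝ) + 1) ^ (θ - 1))
    have h3 : ((t : ℝ) + 1) ^ (θ - 1) * (C * ((t : ℝ) + 1)) = C * ((t : ℝ) + 1) ^ θ := by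
      rw [Real.rpow_sub_one ht.ne']; field_simp
    linarith
  have hs : Summable fun t : ℕ => ((t : ℝ) + 1) ^ (θ - 2) := by
    have := (summable_nat_add_iff 1).2 (Real.summable_nat_rpow.2 (by linarith : θ - 2 < -1))
    simpa using this
  refine Summable.of_nonneg_of_le (fun t => div_nonneg (integral_nonneg fun ω => sq_nonneg _)
    (sq_nonneg _)) (fun t => ?_) (hs.mul_left (16 * (1 + |B|) * (1 + C)))
  have ht : 0 < (t : ℝ) + 1 := by positivity
  rw [div_le_iff₀ (by positivity), mul_assoc, Real.rpow_sub ht, Real.rpow_ofNat,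
    div_mul_cancel₀ _ (by positivity), mul_assoc]
  refine (h.integral_sq_rpow_increment_le t).trans ?_
  exact mul_le_mul_of_nonneg_left (hbound t) (by positivity)

end HasIncrementMoments

/-- If the increments of `y` are eventually at least `c` up to fluctuations that average out, then
`y n / n` is eventually at least any `c' < c`. -/
lemma eventually_le_div_of_eventually_le {y d : ℕ → ℝ} {c c' : ℝ} (hc : c' < c)
    (hd : ∀ᶠ t in atTop, c ≤ d t)
    (hy : Tendsto (fun n : ℕ => (n : ℝ)⁻¹ * ∑ t ∈ Finset.range n, (y (t + 1) - y t - d t))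
      atTop (nhds 0)) :
    ∀ᶠ n : ℕ in atTop, c' ≤ y n / n := by
  -- The finitely many deficits of `d` below `c` vanish on averaging.
  have hz : Tendsto (fun t => min (d t - c) 0) atTop (nhds 0) :=
    tendsto_const_nhds.congr' (by
      filter_upwards [hd] with t ht
      rw [min_eq_right (by linarith)])
  have h0 : Tendsto (fun n : ℕ => (n : ℝ)⁻¹ * y 0) atTop (nhds 0) := by
    simpa using (tendsto_inv_atTop_nhds_zero_nat (𝕜 := ℝ)).mul_const (y 0)
  have hlim := (hy.add hz.cesaro).add h0
  simp only [add_zero] at hlim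
  filter_upwards [hlim.eventually_const_lt (by linarith : c' - c < 0), eventually_gt_atTop 0]
    with n hn hn0
  have hn0' : (0 : ℝ) < n := by exact_mod_cast hn0
  have h1 : ∑ t ∈ Finset.range n, min (d t - c) 0 ≤ ∑ t ∈ Finset.range n, (d t - c) :=
    Finset.sum_le_sum fun t _ => min_le_left _ _
  rw [← mul_add, ← mul_add] at hn
  rw [Finset.sum_sub_distrib, Finset.sum_range_sub] at hn
  rw [Finset.sum_sub_distrib] at h1
  simp only [Finset.sum_const, Finset.card_range, nsmul_eq_mul] at h1
  rw [le_div_iff₀ hn0']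
  rw [inv_mul_eq_div, lt_div_iff₀ hn0'] at hn
  nlinarith

lemma eventually_div_le_of_eventually_le {y d : ℕ → ℝ} {c c' : ℝ} (hc : c < c')
    (hd : ∀ᶠ t in atTop, d t ≤ c)
    (hy : Tendsto (fun n : ℕ => (n : ℝ)⁻¹ * ∑ t ∈ Finset.range n, (y (t + 1) - y t - d t))
      atTop (nhds 0)) :
    ∀ᶠ n : ℕ in atTop, y n / n ≤ c' := by
  have h := eventually_le_div_of_eventually_le (y := -y) (d := -d) (neg_lt_neg hc)
    (hd.mono fun t ht => neg_le_neg ht) (by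
      have := hy.neg
      rw [neg_zero] at this
      refine this.congr fun n => ?_
      rw [← mul_neg, ← Finset.sum_neg_distrib]
      congr 1
      refine Finset.sum_congr rfl fun t _ => ?_
      simp only [Pi.neg_apply]; ring)
  filter_upwards [h] with n hn
  simp only [Pi.neg_apply, neg_div] at hn
  exact neg_le_neg_iff.1 hn

/-- Growth of `U ^ (1 + β)` at a linear rate between `(1 + β) a` and `(1 + β) A`. -/
theorem HasIncrementMoments.ae_eventually_rpow_div_bounds [IsProbabilityMeasure P]
    (h : HasIncrementMoments P F U β γ B)
    {a A : ℝ} (ha : 0 < a)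
    (hlow : ∀ c < a, ∃ x₁ : ℝ, ∀ t, ∀ᵐ ω ∂P, x₁ ≤ U t ω → c ≤ U t ω ^ β * meanDrift P F U t ω)
    (hup : ∀ c > A, ∃ x₁ : ℝ, ∀ t, ∀ᵐ ω ∂P, x₁ ≤ U t ω → U t ω ^ β * meanDrift P F U t ω ≤ c)
    (hunb : ∀ᵐ ω ∂P, ∀ K : ℝ, ∃ᶠ t in atTop, K < U t ω) :
    (∀ c < a, ∀ᵐ ω ∂P, ∀ᶠ t : ℕ in atTop, (1 + β) * c ≤ U t ω ^ (1 + β) / t) ∧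
      ∀ c > A, ∀ᵐ ω ∂P, ∀ᶠ t : ℕ in atTop, U t ω ^ (1 + β) / t ≤ (1 + β) * c := by
  have hβ := h.beta_nonneg
  have hp : 0 < 1 + β := by linarith
  -- Transience needs only some positive constant below `a`.
  obtain ⟨x₁, hx₁⟩ := hlow (a / 2) (by linarith)
  have htrans := h.ae_tendsto_atTop (half_pos ha) hx₁ hunb
  obtain ⟨x₂, hx₂⟩ := hup (A + 1) (by simp)
  have hslln := ae_tendsto_average_sub_condExp (F := F)
    (ξ := fun t ω => U (t + 1) ω ^ (1 + β) - U t ω ^ (1 + β))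
    (fun t => (h.stronglyMeasurable_comp (t + 1)
      (by fun_prop : Measurable fun x : ℝ => x ^ (1 + β))).sub
        ((h.stronglyMeasurable_comp t (by fun_prop : Measurable fun x : ℝ => x ^ (1 + β))).mono
          (F.mono t.le_succ)))
    h.memLp_two_rpow_increment (h.summable_integral_sq_rpow_increment hx₂)
  have hb := ae_all_iff.2 h.condExp_rpow_increment_bounds
  constructor
  · intro c hc
    obtain ⟨x₃, hx₃⟩ := hlow ((c + a) / 2) (by linarith)
    filter_upwards [htrans, hslln, hb, ae_all_iff.2 hx₃] with ω h1 h2 h3 h4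
    refine eventually_le_div_of_eventually_le (y := fun t => U t ω ^ (1 + β))
      (c := (1 + β) * ((c + a) / 2)) (by gcongr; linarith) ?_ h2
    filter_upwards [h1.eventually_ge_atTop x₃] with t ht
    exact (mul_le_mul_of_nonneg_left (h4 t ht) hp.le).trans (h3 t).1
  · intro c hc
    -- The gap between (2A+c)/3 and (A+c)/2 is (c-A)/6, which leaves room for the error
    -- U^(β-1)(1+|B|).
    obtain ⟨x₃, hx₃⟩ := hup ((2 * A + c) / 3) (by linarith)
    filter_upwards [htrans, hslln, hb, ae_all_iff.2 hx₃] with ω h1 h2 h3 h4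
    refine eventually_div_le_of_eventually_le (y := fun t => U t ω ^ (1 + β))
      (c := (1 + β) * ((A + c) / 2)) (by gcongr; linarith) ?_ h2
    have hlim : Tendsto (fun t => U t ω ^ (β - 1) * (1 + |B|)) atTop (nhds 0) := by
      have h5 : Tendsto (fun x : ℝ => x ^ (-(1 - β))) atTop (nhds 0) :=
        tendsto_rpow_neg_atTop (by linarith [h.beta_lt])
      simpa using (h5.comp h1).mul_const (1 + |B|)
    filter_upwards [h1.eventually_ge_atTop x₃,
      hlim.eventually_le_const (by nlinarith : 0 < (1 + β) * ((c - A) / 6))] with t ht ht2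
    have h6 := mul_le_mul_of_nonneg_left (h4 t ht) hp.le
    have h7 := (h3 t).2
    linarith

end

/-! ### Passage from the hypotheses on X to the shifted process -/

/-- For fixed x the essential bounds hold off a null set depending on x, so x = X_t cannot simply be
substituted. But φ_t(x) is a constant shift of ψ_t, so the null set for the essential bounds of ψ_t
alone serves every x. -/
lemma IsDriftDecomposition.driftBetween {Ω : Type*} {m : MeasurableSpace Ω} {P : Measure Ω}
    {F : Filtration ℕ m} {X : ℕ → Ω → ℝ} {φ : ℕ → ℝ → ℝ} {ψ : ℕ → Ω → ℝ}
    (h : IsDriftDecomposition P F X φ ψ) :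
    DriftBetween P F X (lowerDrift P φ ψ) (upperDrift P φ ψ) := by
  intro t
  filter_upwards [h.meanDrift_eq t, ae_le_essSup (f := fun ω => (ψ t ω : EReal)) (μ := P),
    ae_essInf_le (f := fun ω => (ψ t ω : EReal)) (μ := P)] with ω h1 h2 h3
  rw [h1]
  constructor
  · refine (iInf_le _ t).trans ?_
    set s := essInf (fun ω' => ((φ t (X t ω) + ψ t ω' : ℝ) : EReal)) P with hs
    have h4 : s - (φ t (X t ω) : EReal) ≤ essInf (fun ω => (ψ t ω : EReal)) P := by
      refine le_essInf_of_ae_le _ ?_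
      filter_upwards [ae_essInf_le (f := fun ω' => ((φ t (X t ω) + ψ t ω' : ℝ) : EReal)) (μ := P)]
        with ω' h5
      rw [EReal.sub_le_iff_le_add (Or.inl (EReal.coe_ne_bot _)) (Or.inl (EReal.coe_ne_top _)),
        add_comm, ← EReal.coe_add]
      exact h5
    have h6 := h4.trans h3
    rw [EReal.sub_le_iff_le_add (Or.inl (EReal.coe_ne_bot _)) (Or.inl (EReal.coe_ne_top _)),
      add_comm, ← EReal.coe_add] at h6
    exact h6
  · refine le_trans ?_ (le_iSup _ t)
    set s := essSup (fun ω' => ((φ t (X t ω) + ψ t ω' : ℝ) : EReal)) P with hs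
    have h4 : essSup (fun ω => (ψ t ω : EReal)) P ≤ s - (φ t (X t ω) : EReal) := by
      refine essSup_le_of_ae_le _ ?_
      filter_upwards [ae_le_essSup (f := fun ω' => ((φ t (X t ω) + ψ t ω' : ℝ) : EReal)) (μ := P)]
        with ω' h5
      rw [EReal.le_sub_iff_add_le (Or.inl (EReal.coe_ne_bot _)) (Or.inl (EReal.coe_ne_top _)),
        add_comm, ← EReal.coe_add]
      exact h5
    have h6 := h2.trans h4
    rw [EReal.le_sub_iff_add_le (Or.inl (EReal.coe_ne_bot _)) (Or.inl (EReal.coe_ne_top _)),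
      add_comm, ← EReal.coe_add] at h6
    exact h6

lemma IsHalfLineProcess.exists_ae_initial_le {Ω : Type*} {m : MeasurableSpace Ω} {P : Measure Ω}
    [IsProbabilityMeasure P] {F : Filtration ℕ m} {S : Set ℝ} {X : ℕ → Ω → ℝ}
    (h : IsHalfLineProcess P F S X) : ∃ x₀ : ℝ, ∀ᵐ ω ∂P, X 0 ω ≤ x₀ := by
  obtain ⟨x₀, -, hx₀⟩ := h.initial
  refine ⟨x₀, ?_⟩
  have hs : MeasurableSet {ω | X 0 ω ≤ x₀} :=
    measurableSet_le ((h.adapted 0).mono (F.le 0) le_rfl) measurable_const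
  have h1 := integral_condExp (F.le 0) (μ := P) (f := {ω | X 0 ω ≤ x₀}.indicator fun _ => (1 : ℝ))
  rw [integral_congr_ae hx₀, integral_indicator_const _ hs] at h1
  simp only [integral_const, probReal_univ, smul_eq_mul, mul_one] at h1
  have h2 : P {ω | X 0 ω ≤ x₀} = 1 := by
    rw [← ENNReal.ofReal_toReal (measure_ne_top P _)]
    change ENNReal.ofReal (P.real _) = 1
    rw [← h1, ENNReal.ofReal_one]
  exact (mem_ae_iff_prob_eq_one hs).2 h2

/-- X_0 is bounded almost surely and each increment is in L^γ. -/
lemma IsHalfLineProcess.memLp {Ω : Type*} {m : MeasurableSpace Ω} {P : Measure Ω}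
    [IsProbabilityMeasure P] {F : Filtration ℕ m} {S : Set ℝ} {X : ℕ → Ω → ℝ} {γ B q : ℝ}
    (h : IsHalfLineProcess P F S X) (hmom : IncrementMomentBound P F X γ B) (hγ : 0 < γ)
    (hq : q ≤ γ) (t : ℕ) : MemLp (X t) (ENNReal.ofReal q) P := by
  have hm : ∀ t, AEStronglyMeasurable (X t) P := fun t =>
    ((h.adapted t).mono (F.le t) le_rfl).aestronglyMeasurable
  induction t with
  | zero =>
    obtain ⟨x₀, hx₀⟩ := h.exists_ae_initial_le
    refine MemLp.of_bound (hm 0) x₀ ?_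
    filter_upwards [hx₀] with ω hω
    rwa [Real.norm_of_nonneg (h.nonneg _ (h.mem 0 ω))]
  | succ t ih =>
    have hd : MemLp (fun ω => X (t + 1) ω - X t ω) (ENNReal.ofReal γ) P := by
      refine (integrable_norm_rpow_iff ((hm (t + 1)).sub (hm t)) (by simpa using hγ) (by simp)).1 ?_
      rw [ENNReal.toReal_ofReal hγ.le]
      exact (hmom t).1
    have := (hd.mono_exponent (ENNReal.ofReal_le_ofReal hq)).add ih
    refine this.congr_norm (hm (t + 1)) (Eventually.of_forall fun ω => ?_)
    simp

lemma IsHalfLineProcess.hasIncrementMoments {Ω : Type*} {m : MeasurableSpace Ω} {P : Measure Ω}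
    [IsProbabilityMeasure P] {F : Filtration ℕ m} {S : Set ℝ} {X : ℕ → Ω → ℝ} {β γ B : ℝ}
    (h : IsHalfLineProcess P F S X) (hmom : IncrementMomentBound P F X γ B)
    (hβ0 : 0 ≤ β) (hβ1 : β < 1) (hγ : 2 + 2 * β < γ) :
    HasIncrementMoments P F (fun t ω => 1 + X t ω) β γ B := by
  have h1 : ∀ t, StronglyMeasurable[F t] fun ω => 1 + X t ω := fun t =>
    ((h.adapted t).const_add 1).stronglyMeasurable
  have h2 : ∀ t, MemLp (fun ω => 1 + X t ω) (ENNReal.ofReal (2 + 2 * β)) P := by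
    intro t
    have hc : MemLp (fun _ : Ω => (1 : ℝ)) (ENNReal.ofReal (2 + 2 * β)) P := memLp_const 1
    have hγ0 : 0 < γ := by linarith
    exact hc.add (h.memLp hmom hγ0 hγ.le t)
  have h3 : IncrementMomentBound P F (fun t ω => 1 + X t ω) γ B := by
    simpa only [IncrementMomentBound, add_sub_add_left_eq_sub] using hmom
  exact ⟨hβ0, hβ1, hγ, fun t ω => le_add_of_nonneg_right (h.nonneg _ (h.mem t ω)), h1, h2, h3⟩

/-! ### Constants and limits -/

lemma escapeConst_le_div_of_le {c β u t : ℝ} (hβ : 0 ≤ β) (hc : 0 ≤ c) (hu : 0 ≤ u) (ht : 0 ≤ t)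
    (h : (1 + β) * c ≤ u ^ (1 + β) / t) : escapeConst c β ≤ u / t ^ (1 / (1 + β)) := by
  have h1 := Real.rpow_le_rpow (by positivity) h (by positivity : 0 ≤ 1 / (1 + β))
  rwa [Real.div_rpow (by positivity) ht, ← Real.rpow_mul hu, mul_one_div_cancel (by positivity),
    Real.rpow_one, mul_comm] at h1

lemma div_le_escapeConst_of_le {c β u t : ℝ} (hβ : 0 ≤ β) (hu : 0 ≤ u) (ht : 0 ≤ t)
    (h : u ^ (1 + β) / t ≤ (1 + β) * c) : u / t ^ (1 / (1 + β)) ≤ escapeConst c β := by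
  have h1 := Real.rpow_le_rpow (by positivity) h (by positivity : 0 ≤ 1 / (1 + β))
  rwa [Real.div_rpow (by positivity) ht, ← Real.rpow_mul hu, mul_one_div_cancel (by positivity),
    Real.rpow_one, mul_comm (1 + β)] at h1

lemma continuous_escapeConst {β : ℝ} (hβ : 0 ≤ β) : Continuous fun c => escapeConst c β :=
  (continuous_id.mul continuous_const).rpow_const fun _ => Or.inr (by positivity)

lemma exists_lower_bound_of_lt_liminf {S : Set ℝ} {β c a : ℝ} {l : ℝ → EReal} (hc : c < a)
    (h : liminf (fun x : ℝ => ((x ^ β : ℝ) : EReal) * l x) (atTop ⊓ 𝓟 S) = (a : EReal)) :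
    ∃ x₁ : ℝ, 0 < x₁ ∧ ∀ x ∈ S, x₁ ≤ x → ∀ d : ℝ, l x ≤ d → c ≤ x ^ β * d := by
  have h1 := eventually_lt_of_lt_liminf (h ▸ EReal.coe_lt_coe_iff.2 hc)
  rw [eventually_inf_principal, eventually_atTop] at h1
  obtain ⟨x₁, hx₁⟩ := h1
  refine ⟨max x₁ 1, by positivity, fun x hxS hx d hd => ?_⟩
  have hx0 : 0 ≤ x := zero_le_one.trans ((le_max_right _ _).trans hx)
  have h2 := (hx₁ x ((le_max_left _ _).trans hx) hxS).le.trans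
    (mul_le_mul_of_nonneg_left hd (EReal.coe_nonneg.2 (Real.rpow_nonneg hx0 β)))
  rw [← EReal.coe_mul] at h2
  exact EReal.coe_le_coe_iff.1 h2

lemma exists_upper_bound_of_limsup_lt {S : Set ℝ} {β c A : ℝ} {u : ℝ → EReal} (hc : A < c)
    (h : limsup (fun x : ℝ => ((x ^ β : ℝ) : EReal) * u x) (atTop ⊓ 𝓟 S) = (A : EReal)) :
    ∃ x₁ : ℝ, 0 < x₁ ∧ ∀ x ∈ S, x₁ ≤ x → ∀ d : ℝ, d ≤ u x → x ^ β * d ≤ c := by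
  have h1 := eventually_lt_of_limsup_lt (h ▸ EReal.coe_lt_coe_iff.2 hc)
  rw [eventually_inf_principal, eventually_atTop] at h1
  obtain ⟨x₁, hx₁⟩ := h1
  refine ⟨max x₁ 1, by positivity, fun x hxS hx d hd => ?_⟩
  have hx0 : 0 ≤ x := zero_le_one.trans ((le_max_right _ _).trans hx)
  have h2 := (mul_le_mul_of_nonneg_left hd
    (EReal.coe_nonneg.2 (Real.rpow_nonneg hx0 β))).trans
      (hx₁ x ((le_max_left _ _).trans hx) hxS).le
  rw [← EReal.coe_mul] at h2
  exact EReal.coe_le_coe_iff.1 h2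

/-- The shift costs a factor (1 + 1/x)^β ≤ 1 + 1/x, and the threshold on x says exactly that c(1 +
1/x) ≤ c'. For d ≤ 0 there is nothing to pay. -/
lemma one_add_rpow_mul_le {x β c c' d : ℝ} (hx : 0 < x) (hβ1 : β ≤ 1) (hc : 0 < c)
    (hcc : c < c') (hxc : c / (c' - c) ≤ x) (h : x ^ β * d ≤ c) : (1 + x) ^ β * d ≤ c' := by
  have hpos : 0 ≤ (1 + x) ^ β := by positivity
  rcases le_total d 0 with hd | hd
  · exact (mul_nonpos_of_nonneg_of_nonpos hpos hd).trans (hc.trans hcc).le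
  · have e : 1 + x = x * (1 + 1 / x) := by field_simp; ring
    have h1 : (1 + 1 / x) ^ β ≤ 1 + 1 / x :=
      Real.rpow_le_self_of_one_le (by simp [hx.le]) hβ1
    rw [e, Real.mul_rpow hx.le (by positivity)]
    have h2 : c * (1 + 1 / x) ≤ c' := by
      rw [div_le_iff₀ (by linarith)] at hxc
      have : c * (1 + 1 / x) = c + c / x := by ring
      rw [this]
      have : c / x ≤ c' - c := by rw [div_le_iff₀ hx]; linarith
      linarith
    calc x ^ β * (1 + 1 / x) ^ β * d ≤ x ^ β * (1 + 1 / x) * d := by gcongr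
      _ = x ^ β * d * (1 + 1 / x) := by ring
      _ ≤ c * (1 + 1 / x) := by gcongr
      _ ≤ c' := h2

/-- Linear growth of `(1 + x t) ^ (1 + β)` at a rate between `(1 + β) a` and `(1 + β) A`, expressed
as growth of `x`. -/
lemma escapeConst_bounds_of_eventually {x : ℕ → ℝ} {β a A : ℝ} (hx : ∀ t, 0 ≤ x t) (hβ0 : 0 ≤ β)
    (ha : 0 < a)
    (h1 : ∀ n : ℕ, ∀ᶠ t : ℕ in atTop,
      (1 + β) * (a - a / 2 * ((n : ℝ) + 1)⁻¹) ≤ (1 + x t) ^ (1 + β) / t)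
    (h2 : ∀ n : ℕ, ∀ᶠ t : ℕ in atTop,
      (1 + x t) ^ (1 + β) / t ≤ (1 + β) * (A + ((n : ℝ) + 1)⁻¹)) :
    (escapeConst a β : EReal)
        ≤ liminf (fun t : ℕ => ((x t / (t : ℝ) ^ (1 / (1 + β)) : ℝ) : EReal)) atTop ∧
    liminf (fun t : ℕ => ((x t / (t : ℝ) ^ (1 / (1 + β)) : ℝ) : EReal)) atTop
        ≤ limsup (fun t : ℕ => ((x t / (t : ℝ) ^ (1 / (1 + β)) : ℝ) : EReal)) atTop ∧
    limsup (fun t : ℕ => ((x t / (t : ℝ) ^ (1 / (1 + β)) : ℝ) : EReal)) atTop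
        ≤ (escapeConst A β : EReal) := by
  have hs0 : Tendsto (fun n : ℕ => ((n : ℝ) + 1)⁻¹) atTop (nhds 0) := by
    simpa using tendsto_one_div_add_atTop_nhds_zero_nat (𝕜 := ℝ)
  refine ⟨?_, liminf_le_limsup, ?_⟩
  -- The subtracted 1/(n+1) absorbs 1 / t^(1/(1+β)), the effect of the shift by 1. The factor a/2
  -- keeps the argument of `escapeConst` positive.
  · have hlim : Tendsto (fun n : ℕ => escapeConst (a - a / 2 * ((n : ℝ) + 1)⁻¹) β
        - ((n : ℝ) + 1)⁻¹) atTop (nhds (escapeConst a β)) := by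
      have h3 := ((continuous_escapeConst hβ0).tendsto a).comp
        (by simpa using (hs0.const_mul (a / 2)).const_sub a :
          Tendsto (fun n : ℕ => a - a / 2 * ((n : ℝ) + 1)⁻¹) atTop (nhds a))
      simpa using h3.sub hs0
    refine le_of_tendsto' (continuous_coe_real_ereal.continuousAt.tendsto.comp hlim) fun n => ?_
    refine le_liminf_of_le (by isBoundedDefault) ?_
    have hpow : Tendsto (fun t : ℕ => 1 / (t : ℝ) ^ (1 / (1 + β))) atTop (nhds 0) := by
      have := (tendsto_rpow_atTop (by positivity : 0 < 1 / (1 + β))).comp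
        (tendsto_natCast_atTop_atTop (R := ℝ))
      simp only [one_div] at this ⊢
      exact this.inv_tendsto_atTop
    filter_upwards [h1 n, hpow.eventually_le_const (by positivity : 0 < ((n : ℝ) + 1)⁻¹)]
      with t ht ht2
    refine EReal.coe_le_coe_iff.2 ?_
    have hn : ((n : ℝ) + 1)⁻¹ ≤ 1 := inv_le_one_of_one_le₀ (by simp)
    have h4 := escapeConst_le_div_of_le hβ0 (by nlinarith)
      (by linarith [hx t]) t.cast_nonneg ht
    simp only [add_div] at h4
    linarith
  · have hlim : Tendsto (fun n : ℕ => escapeConst (A + ((n : ℝ) + 1)⁻¹) β)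
        atTop (nhds (escapeConst A β)) :=
      ((continuous_escapeConst hβ0).tendsto A).comp (by simpa using hs0.const_add A)
    refine ge_of_tendsto' (continuous_coe_real_ereal.continuousAt.tendsto.comp hlim) fun n => ?_
    refine limsup_le_of_le (by isBoundedDefault) ?_
    filter_upwards [h2 n] with t ht
    refine EReal.coe_le_coe_iff.2 ?_
    have h4 := div_le_escapeConst_of_le hβ0 (by linarith [hx t]) t.cast_nonneg ht
    refine le_trans ?_ h4
    gcongr
    simp

/-! ### Assembly -/

/-- Bounds on the rate of escape for a process whose drift lies between two functions of the
state of order `x ^ (-β)`. -/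
theorem escapeBounds_of_driftBetween {Ω : Type*} {m : MeasurableSpace Ω} {P : Measure Ω}
    [IsProbabilityMeasure P] {F : Filtration ℕ m} {S : Set ℝ} {X : ℕ → Ω → ℝ}
    (hX : IsHalfLineProcess P F S X) (hlimsup : LimsupInfinite P X)
    {β : ℝ} (hβ0 : 0 ≤ β) (hβ1 : β < 1) {a A : ℝ} (ha : 0 < a) (hA : 0 < A)
    {γ B : ℝ} (hγ : 2 + 2 * β < γ) (hmom : IncrementMomentBound P F X γ B)
    {l u : ℝ → EReal} (hlu : DriftBetween P F X l u) (has : DriftAsymptotics S β a A l u) :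
    EscapeBounds P X β a A := by
  set U : ℕ → Ω → ℝ := fun t ω => 1 + X t ω with hU
  have hX0 : ∀ t ω, 0 ≤ X t ω := fun t ω => hX.nonneg _ (hX.mem t ω)
  have hdrift : meanDrift P F U = meanDrift P F X := by
    ext t
    simp only [meanDrift, hU, add_sub_add_left_eq_sub]
  have hproc : HasIncrementMoments P F U β γ B := hX.hasIncrementMoments hmom hβ0 hβ1 hγ
  have hlow : ∀ c < a, ∃ x₁ : ℝ, ∀ t, ∀ᵐ ω ∂P, x₁ ≤ U t ω →
      c ≤ U t ω ^ β * meanDrift P F U t ω := by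
    intro c hc
    -- Raising c to at least a/2 makes the drift positive, so that replacing X^β by the larger U^β
    -- preserves the lower bound.
    obtain ⟨x₁, hx₁0, hx₁⟩ := exists_lower_bound_of_lt_liminf
      (max_lt hc (by linarith : a / 2 < a)) has.1
    refine ⟨1 + x₁, fun t => ?_⟩
    filter_upwards [hlu t] with ω hω hx
    have hx' : x₁ ≤ X t ω := by simpa [hU] using hx
    have h1 := hx₁ _ (hX.mem t ω) hx' _ hω.1
    have hxb := Real.rpow_pos_of_pos (hx₁0.trans_le hx') β
    have hd : 0 < meanDrift P F X t ω := by
      refine pos_of_mul_pos_right ?_ hxb.le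
      exact (half_pos ha).trans_le ((le_max_right _ _).trans h1)
    rw [hdrift]
    refine (le_max_left _ _).trans (h1.trans ?_)
    gcongr
    · exact hX0 t ω
    · simp [hU]
  have hup : ∀ c > A, ∃ x₁ : ℝ, ∀ t, ∀ᵐ ω ∂P, x₁ ≤ U t ω →
      U t ω ^ β * meanDrift P F U t ω ≤ c := by
    intro c hc
    obtain ⟨x₁, hx₁0, hx₁⟩ := exists_upper_bound_of_limsup_lt
      (by linarith : A < (A + c) / 2) has.2
    refine ⟨1 + max x₁ ((A + c) / 2 / (c - (A + c) / 2)), fun t => ?_⟩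
    filter_upwards [hlu t] with ω hω hx
    have hx' : max x₁ ((A + c) / 2 / (c - (A + c) / 2)) ≤ X t ω := by
      simpa only [hU, add_le_add_iff_left] using hx
    have hx1 := (le_max_left _ _).trans hx'
    rw [hdrift]
    exact one_add_rpow_mul_le (hx₁0.trans_le hx1) hβ1.le (by linarith) (by linarith)
      ((le_max_right _ _).trans hx') (hx₁ _ (hX.mem t ω) hx1 _ hω.2)
  have hunb : ∀ᵐ ω ∂P, ∀ K : ℝ, ∃ᶠ t in atTop, K < U t ω := by
    filter_upwards [hlimsup] with ω hω K
    have h1 := frequently_lt_of_lt_limsup (f := atTop)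
      (u := fun t => (X t ω : EReal)) (b := (K : EReal)) (by isBoundedDefault)
      (by rw [hω]; exact EReal.coe_lt_top K)
    refine h1.mono fun t ht => ?_
    have := EReal.coe_lt_coe_iff.1 ht
    simp only [hU]; linarith
  obtain ⟨hlo, hhi⟩ := hproc.ae_eventually_rpow_div_bounds ha hlow hup hunb
  -- Countably many constants approaching `a` and `A` suffice, so a single null set is discarded.
  have hlo' := ae_all_iff.2 fun n : ℕ => hlo (a - a / 2 * ((n : ℝ) + 1)⁻¹)
    (by have : 0 < a / 2 * ((n : ℝ) + 1)⁻¹ := by positivity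
        linarith)
  have hhi' := ae_all_iff.2 fun n : ℕ => hhi (A + ((n : ℝ) + 1)⁻¹)
    (by have : 0 < ((n : ℝ) + 1)⁻¹ := by positivity
        linarith)
  filter_upwards [hlo', hhi'] with ω h1 h2
  exact escapeConst_bounds_of_eventually (fun t => hX0 t ω) hβ0 ha h1 h2

/-- The first clause concerns the drift functions given by the explicit formulas; the second
allows any pair of functions of the state that bounds the mean drift. -/
theorem theorem2p3 {Ω : Type*} {m : MeasurableSpace Ω} (P : Measure Ω) [IsProbabilityMeasure P]
    (F : Filtration ℕ m) (S : Set ℝ) (X : ℕ → Ω → ℝ)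
    (hA0 : IsHalfLineProcess P F S X) (hA1 : LimsupInfinite P X)
    (β : ℝ) (hβ0 : 0 ≤ β) (hβ1 : β < 1)
    (a A : ℝ) (ha : 0 < a) (haA : a ≤ A)
    (γ B : ℝ) (hγ : 2 + 2 * β < γ) (hmom : IncrementMomentBound P F X γ B) :
    (∀ (φ : ℕ → ℝ → ℝ) (ψ : ℕ → Ω → ℝ), IsDriftDecomposition P F X φ ψ →
      DriftAsymptotics S β a A (lowerDrift P φ ψ) (upperDrift P φ ψ) →
      EscapeBounds P X β a A) ∧
    (∀ l u : ℝ → EReal, DriftBetween P F X l u → DriftAsymptotics S β a A l u →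
      EscapeBounds P X β a A) := by
  have key : ∀ l u : ℝ → EReal, DriftBetween P F X l u → DriftAsymptotics S β a A l u →
      EscapeBounds P X β a A := fun l u hlu has =>
    escapeBounds_of_driftBetween hA0 hA1 hβ0 hβ1 ha (ha.trans_le haA) hγ hmom hlu has
  exact ⟨fun φ ψ hdec has => key _ _ hdec.driftBetween has, key⟩
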